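/- Let $G$ be a connected Lie group with Lie algebra $\mathfrak g$, acting smoothly on a connected symplectic manifold $(M,\omega)$. For $f,g\in C^\infty(M)$ let $\operatorname{sgrad} f$ be the Hamiltonian vector field, $\omega(\operatorname{sgrad} f,\cdot)=df$, and $\{f,g\}=\omega(\operatorname{sgrad} f,\operatorname{sgrad} g)$. Suppose the action is Hamiltonian: $G$ acts by symplectomorphisms, and there is a smooth moment map $\Phi:M\to\mathfrak g^*$ such that, with $f_\xi(x)=\Phi(x)(\xi)$, the one-parameter group of $\xi\in\mathfrak g$ acting on $M$ is generated by $\operatorname{sgrad} f_\xi$, and $f_{[\xi,\eta]}=\{f_\xi,f_\eta\}$ for all $\xi,\eta\in\mathfrak g$. Put $$\mathcal F_1=\Phi^*C^\infty(\mathfrak g^*)=\{h\circ\Phi : h\in C^\infty(\mathfrak g^*)\},\qquad \mathcal F_2=C^\infty(M)^G,\qquad \mathcal F=\mathcal F_1+\mathcal F_2 .$$ "For general $x$" means for all $x$ in some open dense subset of $M$. For $x\in M$ let $F_x=\operatorname{span}\{df(x): f\in\mathcal F\}\subset T_x^*M$, and let $K_x\subset F_x$ be the kernel of the Poisson structure of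 $M$ restricted to $F_x$. If $\dim F_x$ (respectively $\dim K_x$) has one and the same value for general $x\in M$, this value is called $\operatorname{ddim}\mathcal F$ (respectively $\operatorname{dind}\mathcal F$). **Theorem 2.1.** Assume that there is an integer $m$ such that, for general $x\in M$, $\dim (G\cdot x)=m$ and $$\operatorname{span}\{df(x) : f\in\mathcal F_2\}=\operatorname{ann}\bigl(T_x(G\cdot x)\bigr).$$ Then: 1. $\mathcal F$ is a linear space of smooth functions closed under the Poisson bracket. 2. For all $x$ in some open dense subset of $M$ one has $\dim F_x+\dim K_x=\dim M$, and $\dim F_y$ and $\dim K_y$ are constant for $y$ in a neighbourhood of $x$. 3. If $\operatorname{ddim}\mathcal F$ is defined, then $\operatorname{dind}\mathcal F$ is defined as well and $\mathcal F$ is a complete algebra: $$\operatorname{ddim}\mathcal F+\operatorname{dind}\mathcal F=\dim M .$$ -/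

import Mathlib

open scoped Manifold ContDiff Topology

noncomputable section

namespace Ham

/-- A bilinear form on a finite-dimensional space which is non-degenerate in its first argument
is invertible as a map into the dual. -/
theorem isInvertible_of_nondegenerate {E : Type*} [NormedAddCommGroup E] [NormedSpace ℝ E]
    [FiniteDimensional ℝ E] (B : E →L[ℝ] E →L[ℝ] ℝ)
    (h : ∀ v, (∀ w, B v w = 0) → v = 0) : B.IsInvertible := by
  have hinj : Function.Injective (B : E →ₗ[ℝ] (E →L[ℝ] ℝ)) := by
    rw [injective_iff_map_eq_zero]
    intro v hv
    apply h
    intro w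
    have h1 : B v = 0 := hv
    rw [h1]; rfl
  have hdim : Module.finrank ℝ E = Module.finrank ℝ (E →L[ℝ] ℝ) := by
    rw [← (LinearMap.toContinuousLinearMap (𝕜 := ℝ) (E := E) (F' := ℝ)).finrank_eq]
    exact (Subspace.dual_finrank_eq (K := ℝ) (V := E)).symm
  let e : E ≃ₗ[ℝ] (E →L[ℝ] ℝ) := LinearEquiv.ofInjectiveOfFinrankEq _ hinj hdim
  exact ⟨e.toContinuousLinearEquiv, by ext v w; rfl⟩

/-! ### Symplectic manifolds -/

section Symplectic

variable (E : Type*) [NormedAddCommGroup E] [NormedSpace ℝ E]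
  (M : Type*) [TopologicalSpace M] [ChartedSpace E M]

/-- The cotangent space `T*_x M`. -/
abbrev Cotangent (x : M) : Type _ := TangentSpace 𝓘(ℝ, E) x →L[ℝ] ℝ

variable {M} in
/-- The coefficient `Ω(∂_v, ∂_w)` of a field of bilinear forms, written in the chart at `x₀`;
here `∂_v` is the constant vector field `v` of the chart. -/
def chartCoeff
    (Ω : ∀ x : M, TangentSpace 𝓘(ℝ, E) x →L[ℝ] TangentSpace 𝓘(ℝ, E) x →L[ℝ] ℝ)
    (x₀ : M) (v w : E) (y : E) : ℝ :=
  Ω ((extChartAt 𝓘(ℝ, E) x₀).symm y)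
    (mfderiv 𝓘(ℝ, E) 𝓘(ℝ, E) (extChartAt 𝓘(ℝ, E) x₀).symm y v)
    (mfderiv 𝓘(ℝ, E) 𝓘(ℝ, E) (extChartAt 𝓘(ℝ, E) x₀).symm y w)

/-- A symplectic form on `M`: a smooth, closed, non-degenerate 2-form. -/
structure SymplecticForm [IsManifold 𝓘(ℝ, E) ∞ M] where
  /-- the bilinear form on each tangent space -/
  form : ∀ x : M, TangentSpace 𝓘(ℝ, E) x →L[ℝ] TangentSpace 𝓘(ℝ, E) x →L[ℝ] ℝ
  smooth : ContMDiff 𝓘(ℝ, E) (𝓘(ℝ, E).prod 𝓘(ℝ, E →L[ℝ] E →L[ℝ] ℝ)) ∞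
    (fun x ↦ Bundle.TotalSpace.mk' (E →L[ℝ] E →L[ℝ] ℝ)
      (E := fun x : M ↦ TangentSpace 𝓘(ℝ, E) x →L[ℝ] TangentSpace 𝓘(ℝ, E) x →L[ℝ] ℝ)
      x (form x))
  alternating : ∀ (x : M) (v : TangentSpace 𝓘(ℝ, E) x), form x v v = 0
  nondegenerate : ∀ (x : M) (v : TangentSpace 𝓘(ℝ, E) x), (∀ w, form x v w = 0) → v = 0
  /-- `dΩ = 0`, in the chart at each point `x₀`, evaluated on constant vector fields. -/
  closed : ∀ (x₀ : M), ∀ y ∈ (extChartAt 𝓘(ℝ, E) x₀).target, ∀ u v w : E,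
    fderiv ℝ (chartCoeff E form x₀ v w) y u + fderiv ℝ (chartCoeff E form x₀ w u) y v
      + fderiv ℝ (chartCoeff E form x₀ u v) y w = 0

end Symplectic

section Poisson

variable {E : Type*} [NormedAddCommGroup E] [NormedSpace ℝ E]
  {M : Type*} [TopologicalSpace M] [ChartedSpace E M] [IsManifold 𝓘(ℝ, E) ∞ M]

/-- The isomorphism `T*_x M → T_x M` inverse to `v ↦ Ω(v, ·)`. -/
def SymplecticForm.sharp (Ω : SymplecticForm E M) (x : M) :
    Cotangent E M x →L[ℝ] TangentSpace 𝓘(ℝ, E) x :=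
  (Ω.form x).inverse

/-- `Ω(α♯, ·) = α`. -/
theorem SymplecticForm.form_sharp [FiniteDimensional ℝ E] (Ω : SymplecticForm E M) (x : M)
    (α : Cotangent E M x) : Ω.form x (Ω.sharp x α) = α := by
  have h : (Ω.form x).IsInvertible :=
    isInvertible_of_nondegenerate (E := E) (Ω.form x) (Ω.nondegenerate x)
  obtain ⟨e, he⟩ := h
  unfold SymplecticForm.sharp
  rw [← he, ContinuousLinearMap.inverse_equiv]
  exact e.apply_symm_apply α

/-- The differential `df(x) ∈ T*_x M` of a real function. -/
def diff (f : M → ℝ) (x : M) : Cotangent E M x := mvfderiv 𝓘(ℝ, E) f x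

/-- The Hamiltonian vector field of `f`: `Ω(sgrad f, ·) = df`. -/
def SymplecticForm.sgrad (Ω : SymplecticForm E M) (f : M → ℝ) (x : M) :
    TangentSpace 𝓘(ℝ, E) x :=
  Ω.sharp x (diff f x)

/-- The Poisson structure as a bilinear form on covectors: `(α, β) ↦ Ω(α♯, β♯)`. -/
def SymplecticForm.poissonTensor (Ω : SymplecticForm E M) (x : M)
    (α β : Cotangent E M x) : ℝ :=
  Ω.form x (Ω.sharp x α) (Ω.sharp x β)

/-- The Poisson bracket `{f, g} = Ω(sgrad f, sgrad g)`. -/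
def SymplecticForm.poisson (Ω : SymplecticForm E M) (f g : M → ℝ) (x : M) : ℝ :=
  Ω.poissonTensor x (diff f x) (diff g x)

/-- The subspace `F_x ⊆ T*_x M` generated by the differentials at `x` of the functions in `A`. -/
def diffSpan (A : Submodule ℝ (M → ℝ)) (x : M) : Submodule ℝ (Cotangent E M x) :=
  Submodule.span ℝ {α | ∃ f ∈ A, α = diff f x}

/-- The kernel `K_x ⊆ F_x` of the Poisson structure restricted to `F_x`. -/
def SymplecticForm.diffKer (Ω : SymplecticForm E M) (A : Submodule ℝ (M → ℝ)) (x : M) :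
    Submodule ℝ (Cotangent E M x) where
  carrier := {α | α ∈ diffSpan A x ∧ ∀ β ∈ diffSpan (E := E) A x, Ω.poissonTensor x α β = 0}
  zero_mem' := ⟨zero_mem _, fun β _ ↦ by simp [SymplecticForm.poissonTensor]⟩
  add_mem' := by
    rintro α α' ⟨h1, h2⟩ ⟨h1', h2'⟩
    refine ⟨add_mem h1 h1', fun β hβ ↦ ?_⟩
    have := h2 β hβ
    have := h2' β hβ
    simp_all [SymplecticForm.poissonTensor]
  smul_mem' := by
    rintro c α ⟨h1, h2⟩
    refine ⟨Submodule.smul_mem _ c h1, fun β hβ ↦ ?_⟩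
    have := h2 β hβ
    simp_all [SymplecticForm.poissonTensor]

/-- `A` is an algebra of smooth functions with respect to the Poisson bracket: a linear space of
smooth functions closed under the Poisson bracket. -/
structure SymplecticForm.IsPoissonAlgebra (Ω : SymplecticForm E M)
    (A : Submodule ℝ (M → ℝ)) : Prop where
  smooth : ∀ f ∈ A, ContMDiff 𝓘(ℝ, E) 𝓘(ℝ, ℝ) ∞ f
  bracket_mem : ∀ f ∈ A, ∀ g ∈ A, Ω.poisson f g ∈ A

/-- A property holds at a general point: it holds on an open dense set. -/
def ForGeneral {X : Type*} [TopologicalSpace X] (P : X → Prop) : Prop :=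
  ∃ U : Set X, IsOpen U ∧ Dense U ∧ ∀ x ∈ U, P x

/-- The differential dimension `ddim A` exists and equals `l`. -/
def HasDdim (E : Type*) [NormedAddCommGroup E] [NormedSpace ℝ E]
    {M : Type*} [TopologicalSpace M] [ChartedSpace E M]
    [IsManifold 𝓘(ℝ, E) ∞ M] (A : Submodule ℝ (M → ℝ)) (l : ℕ) : Prop :=
  ForGeneral fun x : M ↦ Module.finrank ℝ (diffSpan (E := E) A x) = l

/-- The differential index `dind A` exists and equals `r`. -/
def SymplecticForm.HasDind (Ω : SymplecticForm E M) (A : Submodule ℝ (M → ℝ)) (r : ℕ) : Prop :=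
  ForGeneral fun x : M ↦ Module.finrank ℝ (Ω.diffKer A x) = r

/-- `A` is a complete algebra: it is closed under the Poisson bracket, `ddim A` and `dind A` exist,
and `ddim A + dind A = dim M`. -/
def SymplecticForm.IsComplete (Ω : SymplecticForm E M) (A : Submodule ℝ (M → ℝ)) : Prop :=
  Ω.IsPoissonAlgebra A ∧
    ∃ l r : ℕ, HasDdim E A l ∧ Ω.HasDind A r ∧ l + r = Module.finrank ℝ E

end Poisson

/-! ### Hamiltonian actions -/

section Action

variable {F : Type*} [NormedAddCommGroup F] [NormedSpace ℝ F]
  {G : Type*} [TopologicalSpace G] [ChartedSpace F G] [Group G]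
  {E : Type*} [NormedAddCommGroup E] [NormedSpace ℝ E]
  {M : Type*} [TopologicalSpace M] [ChartedSpace E M] [MulAction G M]

/-- The value at `x` of the vector field `ξ_M` generating the one-parameter group of
transformations `exp (t ξ)`: the image of `ξ ∈ T_1 G` under the differential at `1` of the orbit
map `g ↦ g • x`, as a linear map in `ξ`. -/
def infinitesimal (F : Type*) [NormedAddCommGroup F] [NormedSpace ℝ F]
    (G : Type*) [TopologicalSpace G] [ChartedSpace F G] [Group G]
    {E : Type*} [NormedAddCommGroup E] [NormedSpace ℝ E]
    {M : Type*} [TopologicalSpace M] [ChartedSpace E M] [MulAction G M] (x : M) :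
    GroupLieAlgebra 𝓘(ℝ, F) G →L[ℝ] TangentSpace 𝓘(ℝ, E) x :=
  mfderiv 𝓘(ℝ, F) 𝓘(ℝ, E) (fun g : G ↦ g • x) 1

/-- The tangent space at `x` to the orbit `G • x`. -/
def orbitTangent (F : Type*) [NormedAddCommGroup F] [NormedSpace ℝ F]
    (G : Type*) [TopologicalSpace G] [ChartedSpace F G] [Group G]
    {E : Type*} [NormedAddCommGroup E] [NormedSpace ℝ E]
    {M : Type*} [TopologicalSpace M] [ChartedSpace E M] [MulAction G M] (x : M) :
    Submodule ℝ (TangentSpace 𝓘(ℝ, E) x) :=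
  (infinitesimal F G (E := E) x).range

/-- The annihilator in `T*_x M` of a subspace of `T_x M`. -/
def ann {x : M} (W : Submodule ℝ (TangentSpace 𝓘(ℝ, E) x)) : Submodule ℝ (Cotangent E M x) where
  carrier := {α | ∀ v ∈ W, α v = 0}
  zero_mem' := fun v _ ↦ by simp
  add_mem' := fun ha hb v hv ↦ by simp [ha v hv, hb v hv]
  smul_mem' := fun c a ha v hv ↦ by simp [ha v hv]

/-- The action of `G` on `(M, Ω)` is Hamiltonian with moment map `Φ`. The Lie algebra of `G`
is `T_1 G`, whose underlying space is `F`, so that its dual is `StrongDual ℝ F`. -/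
structure IsHamiltonian [IsManifold 𝓘(ℝ, E) ∞ M] (F : Type*) [NormedAddCommGroup F]
    [NormedSpace ℝ F] (G : Type*) [TopologicalSpace G] [ChartedSpace F G] [Group G]
    [MulAction G M] (Ω : SymplecticForm E M) (Φ : M → StrongDual ℝ F) : Prop where
  /-- `G` acts by symplectomorphisms. -/
  symplectic : ∀ (g : G) (x : M) (v w : TangentSpace 𝓘(ℝ, E) x),
    Ω.form (g • x) (mfderiv 𝓘(ℝ, E) 𝓘(ℝ, E) (fun y : M ↦ g • y) x v)
      (mfderiv 𝓘(ℝ, E) 𝓘(ℝ, E) (fun y : M ↦ g • y) x w) = Ω.form x v w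
  smooth : ContMDiff 𝓘(ℝ, E) 𝓘(ℝ, StrongDual ℝ F) ∞ Φ
  /-- The one-parameter group of `ξ` is generated by the Hamiltonian field of `f_ξ = Φ(·)(ξ)`. -/
  generates : ∀ (ξ : GroupLieAlgebra 𝓘(ℝ, F) G) (x : M),
    Ω.sgrad (fun y ↦ Φ y ξ) x = infinitesimal F G x ξ
  bracket : ∀ (ξ η : GroupLieAlgebra 𝓘(ℝ, F) G) (x : M),
    Φ x (⁅ξ, η⁆ : GroupLieAlgebra 𝓘(ℝ, F) G) =
      Ω.poisson (fun y ↦ Φ y ξ) (fun y ↦ Φ y η) x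

/-- The algebra of collective functions `Φ^* C^∞(𝔤^*)`. -/
def collective (Φ : M → StrongDual ℝ F) : Subalgebra ℝ (M → ℝ) where
  carrier := {f | ∃ h : StrongDual ℝ F → ℝ, ContDiff ℝ ∞ h ∧ f = h ∘ Φ}
  mul_mem' := by
    rintro _ _ ⟨h, hh, rfl⟩ ⟨k, hk, rfl⟩
    exact ⟨h * k, hh.mul hk, rfl⟩
  add_mem' := by
    rintro _ _ ⟨h, hh, rfl⟩ ⟨k, hk, rfl⟩
    exact ⟨h + k, hh.add hk, rfl⟩
  algebraMap_mem' := fun c ↦ ⟨fun _ ↦ c, contDiff_const, rfl⟩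

/-- The algebra of smooth `G`-invariant functions on `M`. -/
def invariants (E : Type*) [NormedAddCommGroup E] [NormedSpace ℝ E] (G : Type*) [Group G]
    (M : Type*) [TopologicalSpace M] [ChartedSpace E M] [MulAction G M] :
    Subalgebra ℝ (M → ℝ) where
  carrier := {f | ContMDiff 𝓘(ℝ, E) 𝓘(ℝ, ℝ) ∞ f ∧ ∀ (g : G) (x : M), f (g • x) = f x}
  mul_mem' := fun ha hb ↦
    ⟨ha.1.mul hb.1, fun g x ↦ by simp only [Pi.mul_apply, ha.2, hb.2]⟩
  add_mem' := fun ha hb ↦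
    ⟨ha.1.add hb.1, fun g x ↦ by simp only [Pi.add_apply, ha.2, hb.2]⟩
  algebraMap_mem' := fun _ ↦ ⟨contMDiff_const, fun _ _ ↦ rfl⟩

/-- The sum `Φ^* C^∞(𝔤^*) + C^∞(M)^G`. -/
def collectiveAddInvariants (E : Type*) [NormedAddCommGroup E] [NormedSpace ℝ E]
    (G : Type*) [Group G] {M : Type*} [TopologicalSpace M] [ChartedSpace E M] [MulAction G M]
    (Φ : M → StrongDual ℝ F) : Submodule ℝ (M → ℝ) :=
  (collective Φ).toSubmodule ⊔ (invariants E G M).toSubmodule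

/-- Invariant functions generically span the annihilator of the orbits: for some `m`, at a general
point `x` the orbit has dimension `m` and `span {df(x) | f ∈ C^∞(M)^G} = ann (T_x (G • x))`. -/
def InvariantsSpan [IsManifold 𝓘(ℝ, E) ∞ M] (F : Type*) [NormedAddCommGroup F]
    [NormedSpace ℝ F] (G : Type*) [TopologicalSpace G] [ChartedSpace F G] [Group G]
    [MulAction G M] : Prop :=
  ∃ m : ℕ, ForGeneral fun x : M ↦
    Module.finrank ℝ (orbitTangent F G (E := E) x) = m ∧
      diffSpan (E := E) (invariants E G M).toSubmodule x = ann (orbitTangent F G x)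

end Action

end Ham

end

/-!
Write `T` for the tangent space of the orbit at `x`, and `⊥` for the orthogonal complement with
respect to the Poisson structure of `T*_x M`. The Hamiltonian field of `f_ξ` generates the action
of `ξ`, so the covectors `α` with `α♯ ∈ T` are exactly the differentials of the functions `f_ξ`, and
they form a subspace `W ⊆ F_x`. Its complement `W^⊥` is `ann T`, which for general `x` is spanned by
differentials of invariants, so it lies in `F_x` as well. Therefore `F_x^⊥ ⊆ W^⊥⊥ = W ⊆ F_x`: the
space `F_x` is coisotropic, its kernel is the full complement `K_x = F_x^⊥`, and since the Poisson
structure is non-degenerate `dim F_x + dim K_x = dim M`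
(`Ham.IsHamiltonian.finrank_add_finrank`).

The dimension of `F_x` is lower semicontinuous in `x`
(`Ham.eventually_finrank_diffSpan_le`) and bounded, hence locally constant on an open dense set; by
the equality above so is `dim K_x`.

For closure under the bracket (`Ham.IsHamiltonian.isPoissonAlgebra`): the bracket of two
collective functions is the pull-back of the Lie-Poisson bracket on the dual of the Lie algebra, a
collective function commutes with an invariant one because the latter is constant on orbits, and
the bracket of two invariants is invariant. That it is also smooth comes from writing the bracket in
a local frame of the tangent bundle (`Ham.SymplecticForm.contMDiff_poisson`).
-/

namespace Ham

/-! ### Linear algebra of the Poisson structure at a point -/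

section Poisson

variable {E : Type*} [NormedAddCommGroup E] [NormedSpace ℝ E]
  {M : Type*} [TopologicalSpace M] [ChartedSpace E M]

theorem diffSpan_mono {A B : Submodule ℝ (M → ℝ)} (h : A ≤ B) (x : M) :
    diffSpan (E := E) A x ≤ diffSpan B x :=
  Submodule.span_mono fun _ ⟨f, hf, hα⟩ ↦ ⟨f, h hf, hα⟩

theorem diff_mem_diffSpan {A : Submodule ℝ (M → ℝ)} {f : M → ℝ} (h : f ∈ A) (x : M) :
    diff (E := E) f x ∈ diffSpan A x :=
  Submodule.subset_span ⟨f, h, rfl⟩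

variable [FiniteDimensional ℝ E]

/-- `Cotangent E M x` is the dual of the model space `E`, through the definition of
`TangentSpace`. -/
instance finiteDimensional_cotangent (x : M) : FiniteDimensional ℝ (Cotangent E M x) :=
  inferInstanceAs (FiniteDimensional ℝ (E →L[ℝ] ℝ))

theorem finrank_cotangent (x : M) :
    Module.finrank ℝ (Cotangent E M x) = Module.finrank ℝ E := by
  change Module.finrank ℝ (E →L[ℝ] ℝ) = _
  rw [← (LinearMap.toContinuousLinearMap (𝕜 := ℝ) (E := E) (F' := ℝ)).finrank_eq]
  exact Subspace.dual_finrank_eq (K := ℝ) (V := E)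

variable [IsManifold 𝓘(ℝ, E) ∞ M]

/-- With `form_sharp`, this makes `♯` a two-sided inverse of `v ↦ Ω(v, ·)`. -/
theorem SymplecticForm.sharp_form (Ω : SymplecticForm E M) (x : M)
    (v : TangentSpace 𝓘(ℝ, E) x) : Ω.sharp x (Ω.form x v) = v := by
  have h : Ω.form x (Ω.sharp x (Ω.form x v) - v) = 0 := by
    rw [map_sub, Ω.form_sharp, sub_self]
  refine sub_eq_zero.1 (Ω.nondegenerate x _ fun w ↦ ?_)
  rw [h]; rfl

theorem SymplecticForm.poissonTensor_apply (Ω : SymplecticForm E M) (x : M)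
    (α β : Cotangent E M x) : Ω.poissonTensor x α β = α (Ω.sharp x β) := by
  rw [SymplecticForm.poissonTensor, Ω.form_sharp]

/-- The Poisson structure at `x` as an algebraic bilinear form on `T*_x M`. -/
noncomputable def SymplecticForm.poissonBilin (Ω : SymplecticForm E M) (x : M) :
    LinearMap.BilinForm ℝ (Cotangent E M x) :=
  LinearMap.mk₂ ℝ (Ω.poissonTensor x)
    (fun α α' β ↦ by simp [Ω.poissonTensor_apply])
    (fun c α β ↦ by simp [Ω.poissonTensor_apply])
    (fun α β β' ↦ by simp [Ω.poissonTensor_apply])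
    (fun c α β ↦ by simp [Ω.poissonTensor_apply])

@[simp] theorem SymplecticForm.poissonBilin_apply (Ω : SymplecticForm E M) (x : M)
    (α β : Cotangent E M x) : Ω.poissonBilin x α β = Ω.poissonTensor x α β := rfl

theorem SymplecticForm.poissonBilin_isAlt (Ω : SymplecticForm E M) (x : M) :
    (Ω.poissonBilin x).IsAlt := fun α ↦ Ω.alternating x (Ω.sharp x α)

theorem SymplecticForm.poissonTensor_neg_flip (Ω : SymplecticForm E M) (x : M)
    (α β : Cotangent E M x) : -Ω.poissonTensor x α β = Ω.poissonTensor x β α :=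
  (Ω.poissonBilin_isAlt x).neg_eq α β

theorem SymplecticForm.poissonBilin_nondegenerate (Ω : SymplecticForm E M) (x : M) :
    (Ω.poissonBilin x).Nondegenerate := by
  refine ((Ω.poissonBilin_isAlt x).isRefl.nondegenerate_iff_separatingLeft).2 fun α h ↦ ?_
  ext v
  have := h (Ω.form x v)
  rwa [Ω.poissonBilin_apply, Ω.poissonTensor_apply, Ω.sharp_form] at this

/-- If `F_x` is coisotropic for the Poisson structure, then its kernel is the whole orthogonal
complement of `F_x`, so that the dimensions are complementary. -/
theorem SymplecticForm.finrank_diffSpan_add_finrank_diffKer (Ω : SymplecticForm E M)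
    (A : Submodule ℝ (M → ℝ)) (x : M)
    (h : (Ω.poissonBilin x).orthogonal (diffSpan A x) ≤ diffSpan A x) :
    Module.finrank ℝ (diffSpan (E := E) A x) + Module.finrank ℝ (Ω.diffKer A x) =
      Module.finrank ℝ E := by
  have hrefl := (Ω.poissonBilin_isAlt x).isRefl
  have hK : Ω.diffKer A x = (Ω.poissonBilin x).orthogonal (diffSpan A x) := by
    ext α
    refine ⟨fun hα β hβ ↦ hrefl _ _ (hα.2 β hβ), fun hα ↦ ⟨h hα, fun β hβ ↦ hrefl _ _ (hα β hβ)⟩⟩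
  rw [hK, LinearMap.BilinForm.finrank_orthogonal (Ω.poissonBilin_nondegenerate x),
    finrank_cotangent]
  have := Submodule.finrank_le (diffSpan (E := E) A x)
  rw [finrank_cotangent] at this
  omega

end Poisson

/-! ### The differentials of collective and invariant functions -/

section Action

variable {F : Type*} [NormedAddCommGroup F] [NormedSpace ℝ F]

theorem apply_mem_collective {M : Type*} (Φ : M → StrongDual ℝ F) (ξ : F) :
    (fun y ↦ Φ y ξ) ∈ collective Φ :=
  ⟨fun p ↦ p ξ, (ContinuousLinearMap.apply ℝ ℝ ξ).contDiff, rfl⟩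

variable {G : Type*} [Group G]
  {E : Type*} [NormedAddCommGroup E] [NormedSpace ℝ E]
  {M : Type*} [TopologicalSpace M] [ChartedSpace E M] [MulAction G M]

theorem collective_le (Φ : M → StrongDual ℝ F) :
    (collective Φ).toSubmodule ≤ collectiveAddInvariants E G Φ := le_sup_left

theorem invariants_le (Φ : M → StrongDual ℝ F) :
    (invariants E G M).toSubmodule ≤ collectiveAddInvariants E G Φ := le_sup_right

variable [TopologicalSpace G] [ChartedSpace F G] [FiniteDimensional ℝ E] [IsManifold 𝓘(ℝ, E) ∞ M]

/-- Let `W` be the space of covectors `α` with `α♯` tangent to the orbit. Then `W ⊆ F_x`, by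
collective functions, and `W^⊥ = ann (T_x (G • x)) ⊆ F_x`, by invariant functions. Hence
`F_x^⊥ ⊆ W^⊥⊥ = W ⊆ F_x`, so that `F_x` is coisotropic. -/
theorem IsHamiltonian.finrank_add_finrank {Ω : SymplecticForm E M} {Φ : M → StrongDual ℝ F}
    (hΦ : IsHamiltonian F G Ω Φ) {x : M}
    (hx : diffSpan (E := E) (invariants E G M).toSubmodule x = ann (orbitTangent F G x)) :
    Module.finrank ℝ (diffSpan (E := E) (collectiveAddInvariants E G Φ) x) +
        Module.finrank ℝ (Ω.diffKer (collectiveAddInvariants E G Φ) x) =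
      Module.finrank ℝ E := by
  apply Ω.finrank_diffSpan_add_finrank_diffKer
  have hrefl := (Ω.poissonBilin_isAlt x).isRefl
  set W : Submodule ℝ (Cotangent E M x) :=
    (orbitTangent F G x).comap (Ω.sharp x).toLinearMap
  -- `α♯` generates the action of some `ξ`, so `α` is the differential of `f_ξ`
  have hW : W ≤ diffSpan (collectiveAddInvariants E G Φ) x := by
    rintro α ⟨ξ, hξ⟩
    have h1 : Ω.sharp x (diff (fun y ↦ Φ y ξ) x) = Ω.sharp x α :=
      (hΦ.generates ξ x).trans hξ
    have h2 : α = diff (fun y ↦ Φ y ξ) x := by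
      rw [← Ω.form_sharp x α, ← h1, Ω.form_sharp]
    rw [h2]
    exact diff_mem_diffSpan (collective_le (G := G) Φ (apply_mem_collective Φ ξ)) x
  have hWo : (Ω.poissonBilin x).orthogonal W ≤ ann (orbitTangent F G x) := by
    intro β hβ v hv
    have := hrefl _ _ (hβ (Ω.form x v) (by
      change Ω.sharp x (Ω.form x v) ∈ orbitTangent F G x
      rwa [Ω.sharp_form]))
    rwa [Ω.poissonBilin_apply, Ω.poissonTensor_apply, Ω.sharp_form] at this
  calc (Ω.poissonBilin x).orthogonal (diffSpan (collectiveAddInvariants E G Φ) x)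
      ≤ (Ω.poissonBilin x).orthogonal ((Ω.poissonBilin x).orthogonal W) :=
        LinearMap.BilinForm.orthogonal_le
          (hWo.trans (hx.symm.le.trans (diffSpan_mono (invariants_le Φ) x)))
    _ = W := LinearMap.BilinForm.orthogonal_orthogonal (Ω.poissonBilin_nondegenerate x) hrefl W
    _ ≤ _ := hW

end Action

/-! ### Local frames: smoothness of the bracket, semicontinuity of the rank -/

section Smooth

open Bundle

variable {E : Type*} [NormedAddCommGroup E] [NormedSpace ℝ E]
  {M : Type*} [TopologicalSpace M] [ChartedSpace E M] [IsManifold 𝓘(ℝ, E) ∞ M]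

/-- The frame of the tangent bundle near `x₀` given by its preferred trivialization. -/
noncomputable def frame (x₀ y : M) : E →L[ℝ] TangentSpace 𝓘(ℝ, E) y :=
  (trivializationAt E (TangentSpace 𝓘(ℝ, E) : M → Type _) x₀).symmL ℝ y

theorem eventually_frame_bijective (x₀ : M) :
    ∀ᶠ y in 𝓝 x₀, Function.Bijective (frame (E := E) x₀ y) := by
  set e := trivializationAt E (TangentSpace 𝓘(ℝ, E) : M → Type _) x₀
  filter_upwards [e.open_baseSet.mem_nhds (FiberBundle.mem_baseSet_trivializationAt' x₀)]
    with y hy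
  exact Function.bijective_iff_has_inverse.2 ⟨e.continuousLinearMapAt ℝ y,
    e.continuousLinearMapAt_symmL hy, e.symmL_continuousLinearMapAt hy⟩

/-- The coefficients of the differential in the frame are its coordinates in the tangent
trivializations, since the trivialization of `TangentSpace 𝓘(ℝ, ℝ)` is the identity. -/
theorem contMDiffAt_diff_frame {f : M → ℝ} (hf : ContMDiff 𝓘(ℝ, E) 𝓘(ℝ, ℝ) ∞ f) (x₀ : M) :
    ContMDiffAt 𝓘(ℝ, E) 𝓘(ℝ, E →L[ℝ] ℝ) ∞
      (fun y ↦ (diff (E := E) f y ∘L frame x₀ y : E →L[ℝ] ℝ)) x₀ := by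
  have h := (hf x₀).mfderiv_const (m := ∞) (by simp)
  refine h.congr_of_eventuallyEq ?_
  set e := trivializationAt E (TangentSpace 𝓘(ℝ, E) : M → Type _) x₀
  filter_upwards [e.open_baseSet.mem_nhds (FiberBundle.mem_baseSet_trivializationAt' x₀)]
    with y hy
  ext v
  have hy' : f y ∈ (trivializationAt ℝ (TangentSpace 𝓘(ℝ, ℝ) : ℝ → Type _) (f x₀)).baseSet := by
    rw [TangentBundle.trivializationAt_baseSet, chartAt_self_eq]
    trivial
  change _ = ContinuousLinearMap.inCoordinates E (TangentSpace 𝓘(ℝ, E)) ℝ (TangentSpace 𝓘(ℝ, ℝ))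
    x₀ y (f x₀) (f y) (mfderiv 𝓘(ℝ, E) 𝓘(ℝ, ℝ) f y) v
  rw [ContinuousLinearMap.inCoordinates_eq hy hy']
  have hv : frame (E := E) x₀ y v = e.symm y v := e.symmL_apply (R := ℝ) hy v
  simp only [ContinuousLinearMap.comp_apply, hv]
  simp [e]
  rfl

/-- The symplectic form has smooth coefficients in the frame. The map `B` is `Ω` read in the
trivialization of the bundle of bilinear forms; it agrees with the frame coefficients only where
that trivialization is defined. -/
theorem contMDiffAt_form_frame (Ω : SymplecticForm E M) (x₀ : M) :
    ∃ B : M → E →L[ℝ] E →L[ℝ] ℝ,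
      ContMDiffAt 𝓘(ℝ, E) 𝓘(ℝ, E →L[ℝ] E →L[ℝ] ℝ) ∞ B x₀ ∧
      ∀ᶠ y in 𝓝 x₀, ∀ v w, B y v w = Ω.form y (frame x₀ y v) (frame x₀ y w) := by
  have h := ((contMDiffAt_hom_bundle _).1 (Ω.smooth x₀)).2
  refine ⟨_, h, ?_⟩
  set e := trivializationAt E (TangentSpace 𝓘(ℝ, E) : M → Type _) x₀
  filter_upwards [e.open_baseSet.mem_nhds (FiberBundle.mem_baseSet_trivializationAt' x₀)]
    with y hy v w
  have := inCoordinates_apply_eq₂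
    (E₁ := fun x : M ↦ TangentSpace 𝓘(ℝ, E) x) (E₂ := fun x : M ↦ TangentSpace 𝓘(ℝ, E) x)
    (F₃ := ℝ) (E₃ := Bundle.Trivial M ℝ) (ϕ := Ω.form y) (v := v) (w := w) hy hy (Set.mem_univ _)
  refine this.trans ?_
  have hv (v : E) : frame (E := E) x₀ y v = e.symm y v := e.symmL_apply (R := ℝ) hy v
  simp [hv, e]

/-- In the frame, `{f, g} = α (B⁻¹ β)` with `α`, `β` the coefficients of `df`, `dg` and `B` those
of `Ω`, and inversion of linear maps is smooth. -/
theorem SymplecticForm.contMDiff_poisson [FiniteDimensional ℝ E] (Ω : SymplecticForm E M)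
    {f g : M → ℝ}
    (hf : ContMDiff 𝓘(ℝ, E) 𝓘(ℝ, ℝ) ∞ f) (hg : ContMDiff 𝓘(ℝ, E) 𝓘(ℝ, ℝ) ∞ g) :
    ContMDiff 𝓘(ℝ, E) 𝓘(ℝ, ℝ) ∞ (Ω.poisson f g) := by
  intro x₀
  obtain ⟨B, hB, hBΩ⟩ := contMDiffAt_form_frame Ω x₀
  have hinv : ∀ᶠ y in 𝓝 x₀, (B y).IsInvertible := by
    filter_upwards [hBΩ, eventually_frame_bijective (E := E) x₀] with y hy hs
    refine isInvertible_of_nondegenerate (B y) fun v hv ↦ ?_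
    have : frame (E := E) x₀ y v = 0 := by
      refine Ω.nondegenerate y _ fun w ↦ ?_
      obtain ⟨w, rfl⟩ := hs.2 w
      rw [← hy, hv]
    exact hs.1 (this.trans (map_zero _).symm)
  have hBinv : ContMDiffAt 𝓘(ℝ, E) 𝓘(ℝ, (E →L[ℝ] ℝ) →L[ℝ] E) ∞ (fun y ↦ (B y).inverse) x₀ :=
    (ContinuousLinearMap.IsInvertible.contDiffAt_map_inverse
      hinv.self_of_nhds).contMDiffAt.comp x₀ hB
  refine ((contMDiffAt_diff_frame hf x₀).clm_apply
    (hBinv.clm_apply (contMDiffAt_diff_frame hg x₀))).congr_of_eventuallyEq ?_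
  filter_upwards [hBΩ, hinv, eventually_frame_bijective (E := E) x₀] with y hy hi hs
  set β : E →L[ℝ] ℝ := diff (E := E) g y ∘L frame x₀ y
  have hβ : B y ((B y).inverse β) = β := by
    obtain ⟨e, he⟩ := hi
    rw [← he, ContinuousLinearMap.inverse_equiv]
    exact e.apply_symm_apply β
  have hsharp : Ω.sharp y (diff g y) = frame x₀ y ((B y).inverse β) := by
    rw [← Ω.sharp_form y (frame x₀ y ((B y).inverse β))]
    congr 1
    ext w
    obtain ⟨w, rfl⟩ := hs.2 w
    rw [← hy, hβ]
    rfl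
  rw [SymplecticForm.poisson, Ω.poissonTensor_apply, hsharp]
  rfl

/-- The dimension of `F_x` is lower semicontinuous: functions whose differentials form a basis of
`F_x` have independent differentials near `x`. -/
theorem eventually_finrank_diffSpan_le [FiniteDimensional ℝ E] {A : Submodule ℝ (M → ℝ)}
    (hA : ∀ f ∈ A, ContMDiff 𝓘(ℝ, E) 𝓘(ℝ, ℝ) ∞ f) (x : M) :
    ∀ᶠ y in 𝓝 x, Module.finrank ℝ (diffSpan (E := E) A x) ≤
      Module.finrank ℝ (diffSpan (E := E) A y) := by
  obtain ⟨b, hb, hspan, hli⟩ :=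
    _root_.exists_linearIndependent ℝ {α : Cotangent E M x | ∃ f ∈ A, α = diff f x}
  have : Finite b := hli.finite
  have : Fintype b := Fintype.ofFinite b
  choose f hfA hf using fun α : b ↦ hb α.2
  have hcard : Module.finrank ℝ (diffSpan (E := E) A x) = Fintype.card b := by
    rw [diffSpan, ← hspan, ← finrank_span_eq_card hli, Subtype.range_coe]
  let c : M → b → E →L[ℝ] ℝ := fun y α ↦ diff (E := E) (f α) y ∘L frame x y
  have hc : ContinuousAt c x := by
    refine continuousAt_pi.2 fun α ↦ ?_
    exact (contMDiffAt_diff_frame (hA _ (hfA α)) x).continuousAt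
  have hcx : LinearIndependent ℝ (c x) := by
    have hs := (eventually_frame_bijective (E := E) x).self_of_nhds
    have hinj : Function.Injective (fun α : Cotangent E M x ↦ (α ∘L frame x x : E →L[ℝ] ℝ)) := by
      intro α β h
      ext v
      obtain ⟨v, rfl⟩ := hs.2 v
      exact DFunLike.congr_fun h v
    let T : Cotangent E M x →ₗ[ℝ] (E →L[ℝ] ℝ) :=
      { toFun := fun α ↦ α ∘L frame x x, map_add' := fun _ _ ↦ rfl, map_smul' := fun _ _ ↦ rfl }
    have := hli.map' T (LinearMap.ker_eq_bot.2 hinj)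
    have hcT : c x = T ∘ ((↑) : b → Cotangent E M x) := by
      ext1 α
      change diff (E := E) (f α) x ∘L frame x x = (α : Cotangent E M x) ∘L frame x x
      rw [← hf α]
    exact hcT ▸ this
  filter_upwards [hc.eventually hcx.eventually] with y hy
  have hy' : LinearIndependent ℝ (fun α : b ↦ diff (E := E) (f α) y) := by
    let T : Cotangent E M y →ₗ[ℝ] (E →L[ℝ] ℝ) :=
      { toFun := fun α ↦ α ∘L frame x y, map_add' := fun _ _ ↦ rfl, map_smul' := fun _ _ ↦ rfl }
    exact LinearIndependent.of_comp T hy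
  rw [hcard, ← finrank_span_eq_card hy']
  refine Submodule.finrank_mono (Submodule.span_le.2 ?_)
  rintro _ ⟨α, rfl⟩
  exact diff_mem_diffSpan (hfA α) y

end Smooth

/-! ### Brackets of collective and invariant functions -/

section Bracket

variable {E : Type*} [NormedAddCommGroup E] [NormedSpace ℝ E]
  {M : Type*} [TopologicalSpace M] [ChartedSpace E M]

theorem diff_comp {H : Type*} [NormedAddCommGroup H] [NormedSpace ℝ H]
    {N : Type*} [TopologicalSpace N] [ChartedSpace H N] {f : M → ℝ} {φ : N → M} {x : N}
    (hf : MDifferentiableAt 𝓘(ℝ, E) 𝓘(ℝ, ℝ) f (φ x))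
    (hφ : MDifferentiableAt 𝓘(ℝ, H) 𝓘(ℝ, E) φ x) :
    diff (E := H) (f ∘ φ) x = diff (E := E) f (φ x) ∘L mfderiv 𝓘(ℝ, H) 𝓘(ℝ, E) φ x :=
  mfderiv_comp x hf hφ

theorem diff_add {f g : M → ℝ} {x : M} (hf : MDifferentiableAt 𝓘(ℝ, E) 𝓘(ℝ, ℝ) f x)
    (hg : MDifferentiableAt 𝓘(ℝ, E) 𝓘(ℝ, ℝ) g x) :
    diff (E := E) (f + g) x = diff f x + diff g x :=
  mvfderiv_add hf hg

variable {F : Type*} [NormedAddCommGroup F] [NormedSpace ℝ F]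

section Invariants

variable {G : Type*} [TopologicalSpace G] [ChartedSpace F G] [Group G] [MulAction G M]
  [ContMDiffSMul 𝓘(ℝ, F) 𝓘(ℝ, E) ∞ G M]

/-- An invariant function is constant along the orbit map, so its differential vanishes on the
generating vector fields. -/
theorem diff_infinitesimal_of_invariant {f : M → ℝ} (hf : f ∈ invariants E G M) (x : M)
    (ξ : GroupLieAlgebra 𝓘(ℝ, F) G) :
    diff (E := E) f x (infinitesimal F G x ξ) = 0 := by
  have hconst : f ∘ (fun g : G ↦ g • x) = fun _ ↦ f x := funext fun g ↦ hf.2 g x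
  have horb : ContMDiff 𝓘(ℝ, F) 𝓘(ℝ, E) ∞ (fun g : G ↦ g • x) :=
    contMDiff_id.smul (I := 𝓘(ℝ, F)) contMDiff_const
  have h := diff_comp (H := F) (x := (1 : G))
    (hf.1.mdifferentiable (by simp) ((1 : G) • x)) (horb.mdifferentiable (by simp) 1)
  rw [hconst, diff, mvfderiv_const] at h
  have h1 := DFunLike.congr_fun h.symm ξ
  -- `h` is an identity at `1 • x`, which is only propositionally equal to `x`
  have key : ∀ y (hy : y = x) (w : E), diff (E := E) f y w = diff (E := E) f x w := by
    rintro _ rfl w; rfl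
  exact (key _ (one_smul G x) _).symm.trans h1

variable [FiniteDimensional ℝ E] [IsManifold 𝓘(ℝ, E) ∞ M]
  {Ω : SymplecticForm E M} {Φ : M → StrongDual ℝ F}

/-- Hamiltonian fields of invariant functions are invariant, as `G` acts by symplectomorphisms. -/
theorem IsHamiltonian.sgrad_smul (hΦ : IsHamiltonian F G Ω Φ) {f : M → ℝ}
    (hf : f ∈ invariants E G M) (g : G) (x : M) :
    Ω.sgrad f (g • x) = mfderiv 𝓘(ℝ, E) 𝓘(ℝ, E) (fun y : M ↦ g • y) x (Ω.sgrad f x) := by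
  have hs : MDifferentiable 𝓘(ℝ, E) 𝓘(ℝ, E) (fun y : M ↦ g • y) :=
    (ContMDiffSMul.contMDiff_const_smul (I := 𝓘(ℝ, F)) (n := ∞) g).mdifferentiable (by simp)
  have hsurj : Function.Surjective (mfderiv 𝓘(ℝ, E) 𝓘(ℝ, E) (fun y : M ↦ g • y) x) := by
    have hinj : Function.Injective (mfderiv 𝓘(ℝ, E) 𝓘(ℝ, E) (fun y : M ↦ g • y) x) := by
      refine (injective_iff_map_eq_zero _).2 fun v hv ↦ Ω.nondegenerate x v fun w ↦ ?_
      rw [← hΦ.symplectic g, hv]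
      simp
    exact LinearMap.injective_iff_surjective (K := ℝ) (V := E) |>.1 hinj
  have hdiff : diff (E := E) f x =
      diff (E := E) f (g • x) ∘L mfderiv 𝓘(ℝ, E) 𝓘(ℝ, E) (fun y : M ↦ g • y) x := by
    rw [← diff_comp (hf.1.mdifferentiable (by simp) (g • x)) (hs x)]
    exact congrArg (fun k ↦ diff (E := E) k x) (funext fun y ↦ (hf.2 g y).symm)
  rw [SymplecticForm.sgrad, ← Ω.sharp_form (g • x) (mfderiv _ _ _ _ _)]
  congr 1
  ext w
  obtain ⟨w, rfl⟩ := hsurj w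
  rw [hΦ.symplectic g, SymplecticForm.sgrad, Ω.form_sharp, hdiff]
  rfl

theorem IsHamiltonian.poisson_invariants (hΦ : IsHamiltonian F G Ω Φ) {f g : M → ℝ}
    (hf : f ∈ invariants E G M) (hg : g ∈ invariants E G M) :
    Ω.poisson f g ∈ invariants E G M := by
  refine ⟨Ω.contMDiff_poisson hf.1 hg.1, fun a x ↦ ?_⟩
  have h := hΦ.symplectic a x (Ω.sgrad f x) (Ω.sgrad g x)
  rw [← hΦ.sgrad_smul hf, ← hΦ.sgrad_smul hg] at h
  exact h

end Invariants

variable [FiniteDimensional ℝ F]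

/-- The `i`-th partial derivative of `h` on `F^*`, in the coordinates given by a basis of `F`. -/
noncomputable def partialDeriv (h : StrongDual ℝ F → ℝ) (i : Fin (Module.finrank ℝ F))
    (p : StrongDual ℝ F) : ℝ :=
  fderiv ℝ h p (LinearMap.toContinuousLinearMap ((Module.finBasis ℝ F).coord i))

theorem contDiff_partialDeriv {h : StrongDual ℝ F → ℝ} (hh : ContDiff ℝ ∞ h)
    (i : Fin (Module.finrank ℝ F)) : ContDiff ℝ ∞ (partialDeriv h i) :=
  (hh.fderiv_right (m := ∞) (by simp)).clm_apply contDiff_const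

/-- The differential of `h ∘ Φ` is a combination of the differentials of the components of the
moment map: `d(h ∘ Φ) = ∑ i, (∂_i h ∘ Φ) df_i`, where `f_i` is `f_ξ` for the `i`-th basis vector. -/
theorem diff_comp_momentMap {Φ : M → StrongDual ℝ F}
    {h : StrongDual ℝ F → ℝ} (hh : ContDiff ℝ ∞ h) {x : M}
    (hΦ : MDifferentiableAt 𝓘(ℝ, E) 𝓘(ℝ, StrongDual ℝ F) Φ x) :
    diff (E := E) (h ∘ Φ) x =
      ∑ i, partialDeriv h i (Φ x) • diff (E := E) (fun y ↦ Φ y (Module.finBasis ℝ F i)) x := by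
  have hd (k : StrongDual ℝ F → ℝ) (hk : DifferentiableAt ℝ k (Φ x))
      (v : TangentSpace 𝓘(ℝ, E) x) : diff (E := E) (k ∘ Φ) x v =
        fderiv ℝ k (Φ x) (mfderiv 𝓘(ℝ, E) 𝓘(ℝ, StrongDual ℝ F) Φ x v) := by
    rw [diff_comp hk.mdifferentiableAt hΦ, diff, mvfderiv, mfderiv_eq_fderiv]
    rfl
  ext v
  rw [hd h (hh.differentiable (by simp) _)]
  set q : StrongDual ℝ F := mfderiv 𝓘(ℝ, E) 𝓘(ℝ, StrongDual ℝ F) Φ x v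
  -- expand the velocity of the moment map in the dual basis
  have hsum : q = ∑ i, q (Module.finBasis ℝ F i) •
      LinearMap.toContinuousLinearMap ((Module.finBasis ℝ F).coord i) := by
    ext ξ
    conv_lhs => rw [← (Module.finBasis ℝ F).sum_repr ξ, map_sum]
    simp [mul_comm]
  have hi (ξ : F) : diff (E := E) (fun y ↦ Φ y ξ) x v = q ξ := by
    have := hd (fun p ↦ p ξ) (ContinuousLinearMap.apply ℝ ℝ ξ).differentiableAt v
    rw [show (fun p : StrongDual ℝ F ↦ p ξ) = ContinuousLinearMap.apply ℝ ℝ ξ from rfl,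
      ContinuousLinearMap.fderiv] at this
    exact this
  conv_lhs => rw [hsum, map_sum]
  rw [sum_apply]
  refine Finset.sum_congr rfl fun i _ ↦ ?_
  rw [map_smul, smul_apply, hi, partialDeriv, smul_eq_mul, smul_eq_mul, mul_comm]

variable {G : Type*} [TopologicalSpace G] [ChartedSpace F G] [Group G]
  [FiniteDimensional ℝ E] [IsManifold 𝓘(ℝ, E) ∞ M] [MulAction G M]
  {Ω : SymplecticForm E M} {Φ : M → StrongDual ℝ F}

/-- `{h ∘ Φ, k ∘ Φ}` is the pull-back of the Lie-Poisson bracket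
`p ↦ ∑ i j, ∂_i h(p) ∂_j k(p) p([b_i, b_j])`. -/
theorem IsHamiltonian.poisson_collective (hΦ : IsHamiltonian F G Ω Φ) {f g : M → ℝ}
    (hf : f ∈ collective Φ) (hg : g ∈ collective Φ) : Ω.poisson f g ∈ collective Φ := by
  obtain ⟨h, hh, rfl⟩ := hf
  obtain ⟨k, hk, rfl⟩ := hg
  let b (i : Fin (Module.finrank ℝ F)) : GroupLieAlgebra 𝓘(ℝ, F) G := Module.finBasis ℝ F i
  let c (i j : Fin (Module.finrank ℝ F)) : F :=
    (⁅b i, b j⁆ : GroupLieAlgebra 𝓘(ℝ, F) G)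
  refine ⟨fun p ↦ ∑ i, ∑ j, partialDeriv h i p * partialDeriv k j p * p (c i j), ?_, ?_⟩
  · refine ContDiff.sum fun i _ ↦ ContDiff.sum fun j _ ↦ ?_
    exact ((contDiff_partialDeriv hh i).mul (contDiff_partialDeriv hk j)).mul
      (ContinuousLinearMap.apply ℝ ℝ (c i j)).contDiff
  · ext x
    have hd := hΦ.smooth.mdifferentiable (by simp) x
    rw [SymplecticForm.poisson, diff_comp_momentMap hh hd, diff_comp_momentMap hk hd,
      ← Ω.poissonBilin_apply, LinearMap.BilinForm.sum_left]
    refine Finset.sum_congr rfl fun i _ ↦ ?_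
    rw [LinearMap.BilinForm.sum_right]
    refine Finset.sum_congr rfl fun j _ ↦ ?_
    rw [LinearMap.BilinForm.smul_left, LinearMap.BilinForm.smul_right, Ω.poissonBilin_apply]
    have := hΦ.bracket (b i) (b j) x
    change Φ x (c i j) = _ at this
    rw [this, mul_assoc]
    rfl

variable [ContMDiffSMul 𝓘(ℝ, F) 𝓘(ℝ, E) ∞ G M]

theorem IsHamiltonian.poisson_collective_invariants (hΦ : IsHamiltonian F G Ω Φ) {f g : M → ℝ}
    (hf : f ∈ collective Φ) (hg : g ∈ invariants E G M) : Ω.poisson f g = 0 := by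
  obtain ⟨h, hh, rfl⟩ := hf
  ext x
  rw [SymplecticForm.poisson, diff_comp_momentMap hh (hΦ.smooth.mdifferentiable (by simp) x),
    ← Ω.poissonBilin_apply, LinearMap.BilinForm.sum_left]
  refine Finset.sum_eq_zero fun i _ ↦ ?_
  rw [LinearMap.BilinForm.smul_left, Ω.poissonBilin_apply, ← Ω.poissonTensor_neg_flip,
    Ω.poissonTensor_apply]
  have hgen : Ω.sharp x (diff (fun y ↦ Φ y (Module.finBasis ℝ F i)) x) = _ :=
    hΦ.generates (Module.finBasis ℝ F i) x
  rw [hgen]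
  exact (congrArg (fun r ↦ _ * -r) (diff_infinitesimal_of_invariant hg x _)).trans (by simp)

/-- The mixed brackets vanish, so only those within each of the two summands remain. -/
theorem IsHamiltonian.isPoissonAlgebra (hΦ : IsHamiltonian F G Ω Φ) :
    Ω.IsPoissonAlgebra (collectiveAddInvariants E G Φ) := by
  have hc {f : M → ℝ} (hf : f ∈ collective Φ) : ContMDiff 𝓘(ℝ, E) 𝓘(ℝ, ℝ) ∞ f := by
    obtain ⟨h, hh, rfl⟩ := hf
    exact hh.contMDiff.comp hΦ.smooth
  refine ⟨fun f hf ↦ ?_, fun f hf g hg ↦ ?_⟩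
  · obtain ⟨f₁, h₁, f₂, h₂, rfl⟩ := Submodule.mem_sup.1 hf
    exact (hc h₁).add h₂.1
  · obtain ⟨f₁, hf₁, f₂, hf₂, rfl⟩ := Submodule.mem_sup.1 hf
    obtain ⟨g₁, hg₁, g₂, hg₂, rfl⟩ := Submodule.mem_sup.1 hg
    rw [Subalgebra.mem_toSubmodule] at hf₁ hf₂ hg₁ hg₂
    have hsum : Ω.poisson (f₁ + f₂) (g₁ + g₂) = Ω.poisson f₁ g₁ + Ω.poisson f₂ g₂ := by
      ext x
      have md {f : M → ℝ} (hf : ContMDiff 𝓘(ℝ, E) 𝓘(ℝ, ℝ) ∞ f) :=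
        hf.mdifferentiable (by simp) x
      have h12 := congrFun (hΦ.poisson_collective_invariants hf₁ hg₂) x
      have h21 := congrFun (hΦ.poisson_collective_invariants hg₁ hf₂) x
      simp only [SymplecticForm.poisson, Pi.zero_apply] at h12 h21
      rw [← Ω.poissonTensor_neg_flip, neg_eq_zero] at h21
      rw [SymplecticForm.poisson, diff_add (md (hc hf₁)) (md hf₂.1),
        diff_add (md (hc hg₁)) (md hg₂.1), ← Ω.poissonBilin_apply, LinearMap.BilinForm.add_left,
        LinearMap.BilinForm.add_right, LinearMap.BilinForm.add_right]
      simp only [Ω.poissonBilin_apply, h12, h21, add_zero, zero_add]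
      rfl
    rw [hsum]
    exact Submodule.add_mem_sup (hΦ.poisson_collective hf₁ hg₁) (hΦ.poisson_invariants hf₂ hg₂)

end Bracket

/-! ### General points -/

/-- A bounded lower semicontinuous function with natural values is locally constant at a general
point: in any open set it is locally constant where its supremum over the set is attained. -/
theorem forGeneral_eventually_eq_of_lowerSemicontinuous {X : Type*} [TopologicalSpace X]
    (d : X → ℕ) (N : ℕ) (hN : ∀ x, d x ≤ N)
    (hd : ∀ x, ∀ᶠ y in 𝓝 x, d x ≤ d y) :
    ForGeneral fun x ↦ ∀ᶠ y in 𝓝 x, d y = d x := by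
  refine ⟨{x | ∀ᶠ y in 𝓝 x, d y = d x}, ?_, ?_, fun x hx ↦ hx⟩
  · refine isOpen_iff_mem_nhds.2 fun x hx ↦ ?_
    filter_upwards [eventually_eventually_nhds.2 hx, hx] with y hy hyx
    filter_upwards [hy] with z hz
    rw [hz, hyx]
  · rw [dense_iff_inter_open]
    rintro U hU ⟨x₀, hx₀⟩
    have hbdd : BddAbove (d '' U) := ⟨N, by rintro _ ⟨x, -, rfl⟩; exact hN x⟩
    obtain ⟨x, hxU, hx⟩ := Nat.sSup_mem (Set.Nonempty.image d ⟨x₀, hx₀⟩) hbdd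
    refine ⟨x, hxU, ?_⟩
    filter_upwards [hd x, hU.mem_nhds hxU] with y hy hyU
    exact le_antisymm (hx ▸ le_csSup hbdd ⟨y, hyU, rfl⟩) hy

theorem ForGeneral.and {X : Type*} [TopologicalSpace X] {P Q : X → Prop} (hP : ForGeneral P)
    (hQ : ForGeneral Q) : ForGeneral fun x ↦ P x ∧ Q x := by
  obtain ⟨U, hU, hUd, hUP⟩ := hP
  obtain ⟨V, hV, hVd, hVQ⟩ := hQ
  exact ⟨U ∩ V, hU.inter hV, hUd.inter_of_isOpen_left hVd hU, fun x hx ↦ ⟨hUP x hx.1, hVQ x hx.2⟩⟩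

theorem ForGeneral.mono {X : Type*} [TopologicalSpace X] {P Q : X → Prop} (hP : ForGeneral P)
    (h : ∀ x, P x → Q x) : ForGeneral Q := by
  obtain ⟨U, hU, hUd, hUP⟩ := hP
  exact ⟨U, hU, hUd, fun x hx ↦ h x (hUP x hx)⟩

theorem ForGeneral.eventually {X : Type*} [TopologicalSpace X] {P : X → Prop}
    (hP : ForGeneral P) : ForGeneral fun x ↦ ∀ᶠ y in 𝓝 x, P y := by
  obtain ⟨U, hU, hUd, hUP⟩ := hP
  exact ⟨U, hU, hUd, fun x hx ↦ Filter.mem_of_superset (hU.mem_nhds hx) hUP⟩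

end Ham

theorem theorem2p1
    {F : Type*} [NormedAddCommGroup F] [NormedSpace ℝ F] [FiniteDimensional ℝ F]
    {G : Type*} [TopologicalSpace G] [ChartedSpace F G] [Group G] [LieGroup 𝓘(ℝ, F) ∞ G]
    [ConnectedSpace G]
    {E : Type*} [NormedAddCommGroup E] [NormedSpace ℝ E] [FiniteDimensional ℝ E]
    {M : Type*} [TopologicalSpace M] [ChartedSpace E M] [IsManifold 𝓘(ℝ, E) ∞ M]
    [T2Space M] [SecondCountableTopology M] [ConnectedSpace M]
    [MulAction G M] [ContMDiffSMul 𝓘(ℝ, F) 𝓘(ℝ, E) ∞ G M]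
    (Ω : Ham.SymplecticForm E M) (Φ : M → StrongDual ℝ F)
    (hΦ : Ham.IsHamiltonian F G Ω Φ)
    (hspan : Ham.InvariantsSpan (E := E) (M := M) F G) :
    -- the sum is closed under the Poisson bracket
    Ω.IsPoissonAlgebra (Ham.collectiveAddInvariants E G Φ) ∧
    -- at a general point both dimensions are locally constant and add up to `dim M`
    (Ham.ForGeneral fun x : M ↦
      Module.finrank ℝ (Ham.diffSpan (E := E) (Ham.collectiveAddInvariants E G Φ) x) +
          Module.finrank ℝ (Ω.diffKer (Ham.collectiveAddInvariants E G Φ) x) =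
        Module.finrank ℝ E ∧
      ∀ᶠ y in 𝓝 x,
        Module.finrank ℝ (Ham.diffSpan (E := E) (Ham.collectiveAddInvariants E G Φ) y) =
          Module.finrank ℝ (Ham.diffSpan (E := E) (Ham.collectiveAddInvariants E G Φ) x) ∧
        Module.finrank ℝ (Ω.diffKer (Ham.collectiveAddInvariants E G Φ) y) =
          Module.finrank ℝ (Ω.diffKer (Ham.collectiveAddInvariants E G Φ) x)) ∧
    -- if `ddim` is defined, then so is `dind`, and the algebra is complete
    ((∃ l : ℕ, Ham.HasDdim E (Ham.collectiveAddInvariants E G Φ) l) →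
      Ω.IsComplete (Ham.collectiveAddInvariants E G Φ)) := by
  have hA := hΦ.isPoissonAlgebra
  have hle (x : M) : Module.finrank ℝ
      (Ham.diffSpan (E := E) (Ham.collectiveAddInvariants E G Φ) x) ≤ Module.finrank ℝ E :=
    (Submodule.finrank_le _).trans_eq (Ham.finrank_cotangent x)
  have hdim : Ham.ForGeneral fun x : M ↦
      Module.finrank ℝ (Ham.diffSpan (E := E) (Ham.collectiveAddInvariants E G Φ) x) +
          Module.finrank ℝ (Ω.diffKer (Ham.collectiveAddInvariants E G Φ) x) =
        Module.finrank ℝ E := by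
    obtain ⟨m, hm⟩ := hspan
    exact hm.mono fun x hx ↦ hΦ.finrank_add_finrank hx.2
  refine ⟨hA, ?_, ?_⟩
  · have hloc := Ham.forGeneral_eventually_eq_of_lowerSemicontinuous _ _ hle
      (Ham.eventually_finrank_diffSpan_le hA.smooth)
    refine (hdim.eventually.and hloc).mono fun x ⟨hx, hl⟩ ↦ ⟨hx.self_of_nhds, ?_⟩
    filter_upwards [hx, hl] with y hy hly
    have := hx.self_of_nhds
    exact ⟨hly, by omega⟩
  · rintro ⟨l, hl⟩
    have hlE : l ≤ Module.finrank ℝ E := by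
      obtain ⟨U, -, hUd, hU⟩ := hl
      obtain ⟨x, hx⟩ := hUd.nonempty
      exact hU x hx ▸ hle x
    refine ⟨hA, l, Module.finrank ℝ E - l, hl, ?_, by omega⟩
    exact (hdim.and hl).mono fun x ⟨hx, hlx⟩ ↦ by omega
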